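/- Let $d\ge 1$, let $\mu$ be a probability measure on $\mathbb R$, put $\Omega=\{\omega\in\mathbb R^{\mathbb Z^d}:\omega_k\in\operatorname{supp}\mu\ \forall k\}$ and $\mathbb P=\bigotimes_{k\in\mathbb Z^d}\mu$. For $u\in\ell^1(\mathbb Z^d;\mathbb R)$ consider the discrete alloy-type model on $\ell^2(\mathbb Z^d)$, $$(h_\omega\psi)(x)=\sum_{\|x-y\|_1=1}(\psi(x)-\psi(y))+\Big(\sum_{k\in\mathbb Z^d}\omega_k u(x-k)\Big)\psi(x).$$ **Notation.** For $z\in\mathbb Z^d$ and $l\in\mathbb N$ let $\mathfrak C_l(z)=([-l,l]^d+z)\cap\mathbb Z^d$, let $h_\omega^{\mathfrak C}=\pi_{\mathfrak C}h_\omega\iota_{\mathfrak C}$ be the restriction of $h_\omega$ to a finite set $\mathfrak C\subset\mathbb Z^d$ (extend by zero, apply $h_\omega$, restrict), and let $\partial^{\rm i}\mathfrak C$ be the set of points of $\mathfrak C$ with fewer than $2d$ nearest neighbours (in $\ell^1$-distance $1$) in $\mathfrak C$. For $m>0$, $E\in\mathbb R$, the cube $\mathfrak C=\mathfrak C_l(z)$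 is *$(m,E)$-regular* for $\omega$ if $E\notin\sigma(h_\omega^{\mathfrak C})$ and $|\langle\delta_z,(h_\omega^{\mathfrak C}-E)^{-1}\delta_w\rangle|\le \mathrm e^{-ml}$ for all $w\in\partial^{\rm i}\mathfrak C$. It is *uniformly $(m,E)$-regular* for $\omega\in\Omega$ if it is $(m,E)$-regular for every $\omega'\in\Omega$ that coincides with $\omega$ on $\mathfrak C_{4l}(z)$. The estimate $G(I,l,m,\xi)$ holds if for all $z_1,z_2\in\mathbb Z^d$ with $\|z_1-z_2\|_\infty>8l$ the set of $\omega\in\Omega$ for which there is $E\in I$ such that neither $\mathfrak C_l(z_1)$ nor $\mathfrak C_l(z_2)$ is uniformly $(m,E)$-regular has (outer) $\mathbb P$-measure at most $l^{-2\xi}$. Let $\xi>2d$, $\kappa\in(1,2\xi/(\xi+2d))$, $\beta\in(2-\kappa,1)$, $q\in(0,1)$, and let $l^*\in\mathbb R$. We say that the *uniform initial scale estimate with parameters $\xi,\kappa,\beta,q$ and threshold $l^*$ holds in $I\subset\mathbb R$* if there are $m_0>0$ and an integer $l_0>1$ with $$l_0\ge l^*,\qquad l_0\ge\Big(\frac{(1-q)m_0}{(1-q)m_0+m_0+1}\Big)^{-\kappa/(1-\beta)},\qquad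 m_0>l_0^{\beta-1},$$ such that $G(I,l_0,m_0,\xi)$ holds. (In the multiscale analysis $l^*$ is the length scale from which on its induction step is valid; here it is an arbitrary number.) We say that *$u$ has negative part of size $\delta>0$* if $u=u_+-\delta u_-$ with $u_\pm\in\ell^1(\mathbb Z^d;[0,\infty))$, $\|u_-\|_1\le1$, and $\operatorname{supp}\mu=[0,\omega_+]$ for some $\omega_+>0$. **Proposition.** Assume $\mathbb P(\omega_0<\epsilon_0)\le\frac1{12}$ for some $\epsilon_0>0$. Let $C,\alpha,\overline u>0$, let $\xi,\kappa,\beta,q,l^*$ be as above, and let $\zeta\in(2-2(1-\beta)/\kappa,2)$. Then there exist $\delta>0$ and $\epsilon_{l_0}>0$, depending only on these data and on $d$, $\mu$, $\epsilon_0$ (on $u$ only through $C,\alpha,\overline u$), such that the following holds for every $u:\mathbb Z^d\to\mathbb R$ with $|u(k)|\le C\mathrm e^{-\alpha\|k\|_1}$ for all $k\in\mathbb Z^d$ and $\sum_{k\in\mathbb Z^d}u(k)=\overline u$: if $u$ has negative part of size $\delta$, then the uniform initial scale estimate with parameters $\xi,\kappa,\beta,q$ and threshold $l^*$ holds in $[-\epsilon_{l_0}/2,\epsilon_{l_0}/2]$.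 -/

import Mathlib

open MeasureTheory

noncomputable section

namespace AlloyModel

/-- The lattice `ℤ^d`. Its norm as a (finite) product of copies of `ℤ` is the sup norm. -/
abbrev Lattice (d : ℕ) : Type := Fin d → ℤ

/-- The `ℓ¹`-norm on `ℤ^d`. -/
def l1Norm {d : ℕ} (k : Lattice d) : ℤ := ∑ i, |k i|

/-- The cube `([-l, l]^d + z) ∩ ℤ^d`, for integer `l`. -/
def box {d : ℕ} (z : Lattice d) (l : ℕ) : Finset (Lattice d) :=
  Finset.Icc (fun i => z i - (l : ℤ)) (fun i => z i + (l : ℤ))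

theorem center_mem_box {d : ℕ} (z : Lattice d) (l : ℕ) : z ∈ box z l := by
  rw [box, Finset.mem_Icc]
  constructor <;> intro i <;> simp

/-- The lattice points at `ℓ¹`-distance one from `x`
(they all lie in the cube of radius one around `x`). -/
def neighbors {d : ℕ} (x : Lattice d) : Finset (Lattice d) :=
  (box x 1).filter (fun y => l1Norm (x - y) = 1)

/-- The interior boundary: points of `Q` with fewer than `2d` neighbors in `Q`. -/
def innerBoundary {d : ℕ} (Q : Finset (Lattice d)) : Finset (Lattice d) :=
  Q.filter (fun k => (Q.filter (fun j => l1Norm (k - j) = 1)).card < 2 * d)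

/-- The alloy-type potential `v_ω(x) = ∑_k ω_k u(x - k)`. -/
def potential {d : ℕ} (u ω : Lattice d → ℝ) (x : Lattice d) : ℝ :=
  ∑' k, ω k * u (x - k)

/-- The discrete alloy-type Schrödinger operator `h_ω = h_0 + v_ω`, acting on functions on `ℤ^d`,
where `(h_0 ψ)(x) = ∑_{‖x - y‖₁ = 1} (ψ(x) - ψ(y))`. -/
def hamiltonian {d : ℕ} (u ω : Lattice d → ℝ) (ψ : Lattice d → ℝ) (x : Lattice d) : ℝ :=
  (∑ y ∈ neighbors x, (ψ x - ψ y)) + potential u ω x * ψ x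

/-- The restriction of `h_ω` to a finite set `Q` (extend by zero, apply `h_ω`, restrict to `Q`), as
a matrix: its `(x, y)` entry is `⟨δ_x, h_ω δ_y⟩`. -/
def boxHamiltonian {d : ℕ} (u ω : Lattice d → ℝ) (Q : Finset (Lattice d)) : Matrix Q Q ℝ :=
  Matrix.of fun x y => hamiltonian u ω (Pi.single (y : Lattice d) 1) x

/-- The Green's function `⟨δ_x, (h_ω^Q - E)⁻¹ δ_y⟩`, for `E` outside the spectrum. -/
def green {d : ℕ} (u ω : Lattice d → ℝ) (Q : Finset (Lattice d)) (E : ℝ) (x y : Q) : ℝ :=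
  (boxHamiltonian u ω Q - E • (1 : Matrix Q Q ℝ))⁻¹ x y

/-- The cube of radius `l` around `z` is `(m, E)`-regular for `ω`. -/
def IsRegular {d : ℕ} (u : Lattice d → ℝ) (z : Lattice d) (l : ℕ) (m E : ℝ)
    (ω : Lattice d → ℝ) : Prop :=
  E ∉ spectrum ℝ (boxHamiltonian u ω (box z l)) ∧
    ∀ w : box z l, (w : Lattice d) ∈ innerBoundary (box z l) →
      |green u ω (box z l) E ⟨z, center_mem_box z l⟩ w| ≤ Real.exp (-m * l)

/-- The space of configurations: all coupling constants lie in the support of `μ`. -/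
def configurations (d : ℕ) (μ : Measure ℝ) : Set (Lattice d → ℝ) :=
  {ω | ∀ k, ω k ∈ μ.support}

/-- The law of the i.i.d. coupling constants `(ω_k)`, `k ∈ ℤ^d`: the product measure `⊗_k μ`
(it is carried by `configurations d μ`). -/
def couplingLaw (d : ℕ) (μ : Measure ℝ) [IsProbabilityMeasure μ] : Measure (Lattice d → ℝ) :=
  Measure.infinitePi (fun _ : Lattice d => μ)

/-- The cube of radius `l` around `z` is uniformly `(m, E)`-regular for `ω`: it is
`(m, E)`-regular for every configuration that agrees with `ω` on the cube of radius `4l`. -/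
def IsUniformlyRegular {d : ℕ} (μ : Measure ℝ) (u : Lattice d → ℝ) (z : Lattice d) (l : ℕ)
    (m E : ℝ) (ω : Lattice d → ℝ) : Prop :=
  ∀ ω' ∈ configurations d μ, (∀ k ∈ box z (4 * l), ω' k = ω k) → IsRegular u z l m E ω'

/-- The event that for some energy in `I` neither of the cubes of radius `l` around `z₁` and `z₂`
is uniformly `(m, E)`-regular. -/
def badEvent {d : ℕ} (μ : Measure ℝ) (u : Lattice d → ℝ) (l : ℕ) (z₁ z₂ : Lattice d) (m : ℝ)
    (I : Set ℝ) : Set (Lattice d → ℝ) :=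
  {ω | ω ∈ configurations d μ ∧ ∃ E ∈ I,
    ¬ IsUniformlyRegular μ u z₁ l m E ω ∧ ¬ IsUniformlyRegular μ u z₂ l m E ω}

/-- The multiscale estimate `G(I, l, m, ξ)`. The bound is on the outer measure of the bad event,
so that nothing is claimed through a measurability convention. -/
def MultiscaleEstimate {d : ℕ} (μ : Measure ℝ) [IsProbabilityMeasure μ] (u : Lattice d → ℝ)
    (I : Set ℝ) (l : ℕ) (m ξ : ℝ) : Prop :=
  ∀ z₁ z₂ : Lattice d, 8 * (l : ℝ) < ‖z₁ - z₂‖ →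
    couplingLaw d μ (badEvent μ u l z₁ z₂ m I) ≤ ENNReal.ofReal ((l : ℝ) ^ (-2 * ξ))

/-- The admissible exponents of the multiscale analysis in dimension `d`. -/
structure AdmissibleParameters (d : ℕ) (ξ κ β q : ℝ) : Prop where
  two_mul_dim_lt : 2 * (d : ℝ) < ξ
  one_lt_kappa : 1 < κ
  kappa_lt : κ < 2 * ξ / (ξ + 2 * d)
  two_sub_lt_beta : 2 - κ < β
  beta_lt_one : β < 1
  q_pos : 0 < q
  q_lt_one : q < 1

/-- The length scale
`((1 - q) m₀ / ((1 - q) m₀ + m₀ + 1)) ^ (-κ / (1 - β))`, which controls the total loss of mass. -/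
def massLossScale (β κ q m₀ : ℝ) : ℝ :=
  ((1 - q) * m₀ / ((1 - q) * m₀ + m₀ + 1)) ^ (-κ / (1 - β))

/-- The (uniform) initial scale estimate in `I` with exponents `ξ, κ, β, q`; the number `lstar` is
the length scale above which the induction step of the multiscale analysis applies. -/
def InitialScaleEstimate {d : ℕ} (μ : Measure ℝ) [IsProbabilityMeasure μ] (u : Lattice d → ℝ)
    (I : Set ℝ) (lstar ξ κ β q : ℝ) : Prop :=
  AdmissibleParameters d ξ κ β q ∧
    ∃ (m₀ : ℝ) (l₀ : ℕ), 0 < m₀ ∧ 1 < l₀ ∧ lstar ≤ (l₀ : ℝ) ∧ massLossScale β κ q m₀ ≤ (l₀ : ℝ) ∧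
      (l₀ : ℝ) ^ (β - 1) < m₀ ∧ MultiscaleEstimate μ u I l₀ m₀ ξ

/-- Exponential decay of the single-site potential with constants `C` and `α`. -/
def ExponentialDecay {d : ℕ} (u : Lattice d → ℝ) (C α : ℝ) : Prop :=
  ∀ k, |u k| ≤ C * Real.exp (-α * (l1Norm k : ℝ))

/-- `u` has negative part of size `δ`, and the support of `μ` is an interval `[0, ω₊]`. -/
def SmallNegativePart {d : ℕ} (u : Lattice d → ℝ) (μ : Measure ℝ) (δ : ℝ) : Prop :=
  (∃ uPos uNeg : Lattice d → ℝ, (∀ k, 0 ≤ uPos k) ∧ (∀ k, 0 ≤ uNeg k) ∧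
      Summable uPos ∧ Summable uNeg ∧ ∑' k, uNeg k ≤ 1 ∧ ∀ k, u k = uPos k - δ * uNeg k) ∧
    ∃ ωplus : ℝ, 0 < ωplus ∧ μ.support = Set.Icc 0 ωplus

end AlloyModel

end

open MeasureTheory

noncomputable section

namespace AlloyModel

/-! The sum of `u` is fixed and its tails are uniformly small, so `u` is at least some `c₀ > 0` at a
site `k₀` of a fixed finite set. All couplings are nonnegative, so the potential is at least a
constant `c` wherever the coupling shifted by `k₀` is large, up to an error `δ * W` from the
negative part.

Segments of length `r` in one coordinate direction that start in the cube all contain a large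
coupling, outside an event of probability at most `(2l+1)^d * 12^(-r)`. If they do, a
one-dimensional Poincaré inequality (`tsum_sq_le_of_hits`) bounds the restricted Hamiltonian below
by about `c / (2r²)`. The bound survives conjugation with `exp (η ρ)` for `η` of order `1 / r`, so a
Combes–Thomas argument (`isRegular_of_hits`) gives decay of the Green's function at rate of order `1
/ r`. Only couplings within `2l` of the center enter the good event, which makes the regularity
uniform.

With `l = r ^ N` the mass `1 / r` is only polynomially small in `l`, while the probability is
exponentially small in `r`; `exists_scales` makes all requirements hold at once. The scales do not
depend on `u`, so `δ` can be chosen afterwards, of order `r⁻²`. -/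

/-! ### Nearest neighbors and cubes in the lattice -/

/-- The `i`-th unit vector of the lattice. -/
abbrev unitVec {d : ℕ} (i : Fin d) : Lattice d := Pi.single i 1

theorem l1Norm_unitVec {d : ℕ} (i : Fin d) : l1Norm (unitVec i) = 1 := by
  unfold l1Norm unitVec
  rw [Finset.sum_eq_single i]
  · simp
  · intro j _ hj
    simp [hj]
  · simp

theorem l1Norm_neg {d : ℕ} (k : Lattice d) : l1Norm (-k) = l1Norm k := by
  simp [l1Norm]

theorem exists_unitVec_of_l1Norm_eq_one {d : ℕ} {k : Lattice d} (h : l1Norm k = 1) :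
    ∃ i, k = unitVec i ∨ k = -unitVec i := by
  have hex : ∃ i, k i ≠ 0 := by
    by_contra! hk
    simp [l1Norm, hk] at h
  obtain ⟨i, hi⟩ := hex
  have hsplit : |k i| + ∑ j ∈ Finset.univ.erase i, |k j| = 1 := by
    rw [← h, l1Norm, Finset.add_sum_erase _ (fun j => |k j|) (Finset.mem_univ i)]
  have hpos : 1 ≤ |k i| := Int.one_le_abs hi
  have hnn : 0 ≤ ∑ j ∈ Finset.univ.erase i, |k j| := Finset.sum_nonneg fun j _ => abs_nonneg _
  have hz : ∑ j ∈ Finset.univ.erase i, |k j| = 0 := by omega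
  have hone : |k i| = 1 := by omega
  have hj : ∀ j, j ≠ i → k j = 0 := by
    intro j hji
    have := (Finset.sum_eq_zero_iff_of_nonneg fun j _ => abs_nonneg (k j)).1 hz j
      (Finset.mem_erase.2 ⟨hji, Finset.mem_univ j⟩)
    exact abs_eq_zero.1 this
  refine ⟨i, ?_⟩
  rcases (abs_eq zero_le_one).1 hone with h1 | h1
  · left
    funext j
    by_cases hji : j = i
    · subst hji; simp [h1]
    · simp [hj j hji, hji]
  · right
    funext j
    by_cases hji : j = i
    · subst hji; simp [h1]
    · simp [hj j hji, hji]

/-- The `2d` lattice steps of length one. -/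
def step {d : ℕ} (p : Fin d × Bool) : Lattice d := if p.2 then unitVec p.1 else -unitVec p.1

theorem step_injective {d : ℕ} : Function.Injective (step (d := d)) := by
  rintro ⟨i, a⟩ ⟨j, b⟩ h
  have hi := congrFun h i
  by_cases hij : i = j
  · subst hij
    cases a <;> cases b <;> simp [step] at hi ⊢
  · cases a <;> cases b <;> simp [step, hij] at hi

theorem l1Norm_step {d : ℕ} (p : Fin d × Bool) : l1Norm (step p) = 1 := by
  unfold step
  split_ifs
  · exact l1Norm_unitVec _
  · rw [l1Norm_neg, l1Norm_unitVec]

theorem abs_apply_le_l1Norm {d : ℕ} (k : Lattice d) (i : Fin d) : |k i| ≤ l1Norm k :=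
  Finset.single_le_sum (f := fun i => |k i|) (fun _ _ => abs_nonneg _) (Finset.mem_univ i)

theorem mem_box {d : ℕ} {z x : Lattice d} {l : ℕ} : x ∈ box z l ↔ ∀ i, |x i - z i| ≤ l := by
  simp only [box, Finset.mem_Icc, Pi.le_def, abs_le]
  constructor
  · rintro ⟨h1, h2⟩ i
    have := h1 i
    have := h2 i
    constructor <;> omega
  · intro h
    constructor <;> intro i <;> have := h i <;> omega

theorem neighbors_eq_image {d : ℕ} (x : Lattice d) :
    neighbors x = Finset.univ.image fun p : Fin d × Bool => x + step p := by
  ext y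
  simp only [neighbors, Finset.mem_filter, Finset.mem_image, Finset.mem_univ, true_and]
  constructor
  · rintro ⟨-, h⟩
    obtain ⟨i, hi | hi⟩ := exists_unitVec_of_l1Norm_eq_one h
    · exact ⟨(i, false), by simp [step, ← hi]⟩
    · exact ⟨(i, true), by
        have : unitVec i = y - x := by rw [← neg_sub x y, hi, neg_neg]
        simp [step, this]⟩
  · rintro ⟨p, rfl⟩
    have h : l1Norm (x - (x + step p)) = 1 := by
      rw [sub_add_cancel_left, l1Norm_neg, l1Norm_step]
    refine ⟨mem_box.2 fun i => ?_, h⟩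
    have := abs_apply_le_l1Norm (step p) i
    rw [l1Norm_step] at this
    simpa using this

theorem sum_neighbors {d : ℕ} (x : Lattice d) (f : Lattice d → ℝ) :
    ∑ y ∈ neighbors x, f y = ∑ i, (f (x + unitVec i) + f (x - unitVec i)) := by
  rw [neighbors_eq_image, Finset.sum_image fun p _ q _ h => step_injective (add_left_cancel h),
    Fintype.sum_prod_type]
  refine Finset.sum_congr rfl fun i _ => ?_
  simp [step, sub_eq_add_neg]

/-- A point of the inner boundary of a cube has distance at least `l` from its center. -/
theorem le_norm_sub_of_mem_innerBoundary {d : ℕ} {z w : Lattice d} {l : ℕ}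
    (hw : w ∈ innerBoundary (box z l)) : (l : ℝ) ≤ ‖z - w‖ := by
  rw [innerBoundary, Finset.mem_filter] at hw
  obtain ⟨hwb, hcard⟩ := hw
  by_contra! hlt
  have hcoord : ∀ i, |w i - z i| < l := by
    intro i
    have h1 : ‖(z - w) i‖ < l := (norm_le_pi_norm (z - w) i).trans_lt hlt
    rw [Pi.sub_apply, Int.norm_eq_abs, ← Int.cast_abs, abs_sub_comm] at h1
    exact_mod_cast h1
  refine absurd hcard (not_lt.2 ?_)
  have hsub : (Finset.univ.image fun p : Fin d × Bool => w + step p) ⊆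
      (box z l).filter fun j => l1Norm (w - j) = 1 := by
    intro y hy
    obtain ⟨p, -, rfl⟩ := Finset.mem_image.1 hy
    rw [Finset.mem_filter]
    refine ⟨mem_box.2 fun i => ?_, by rw [sub_add_cancel_left, l1Norm_neg, l1Norm_step]⟩
    have h1 := abs_apply_le_l1Norm (step p) i
    rw [l1Norm_step] at h1
    have h2 := hcoord i
    have h3 : |(w + step p) i - z i| ≤ |w i - z i| + |step p i| := by
      rw [Pi.add_apply, add_sub_right_comm]
      exact abs_add_le _ _
    omega
  have hc := Finset.card_le_card hsub
  rw [Finset.card_image_of_injective _ fun p q h => step_injective (add_left_cancel h)] at hc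
  simpa [mul_comm] using hc

theorem norm_unitVec_le {d : ℕ} (i : Fin d) : ‖unitVec i‖ ≤ 1 := by
  refine (pi_norm_le_iff_of_nonneg zero_le_one).2 fun j => ?_
  by_cases h : j = i
  · subst h; simp
  · simp [h]

/-! ### Finitely supported functions -/

theorem summable_comp_add {d : ℕ} {f : Lattice d → ℝ} (hf : Summable f) (a : Lattice d) :
    Summable fun x => f (x + a) :=
  (Equiv.addRight a).summable_iff.2 hf

theorem tsum_comp_add {d : ℕ} (f : Lattice d → ℝ) (a : Lattice d) :
    ∑' x, f (x + a) = ∑' x, f x :=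
  (Equiv.addRight a).tsum_eq f

theorem summable_mul_of_finite_support {d : ℕ} {F : Lattice d → ℝ} (hF : F.support.Finite)
    (G : Lattice d → ℝ) : Summable fun x => F x * G x :=
  summable_of_hasFiniteSupport <| hF.subset fun x hx hx' => hx (by
    simp only [Function.notMem_support.1 (fun h => h hx'), zero_mul])

/-- One-dimensional Poincaré inequality along the direction `e`: if from every point one meets
within `r` steps a zero of `F` or a point of `S`, then `‖F‖²` is controlled by the mass of `F` on `S`
and the Dirichlet form of `F` in the direction `e`. -/
theorem tsum_sq_le_of_hits {d : ℕ} {F : Lattice d → ℝ} (hF : F.support.Finite) (e : Lattice d)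
    (S : Set (Lattice d)) (r : ℕ)
    (hit : ∀ x, ∃ j < r, F (x + j • e) = 0 ∨ x + j • e ∈ S) :
    ∑' x, F x ^ 2 ≤ 2 * r * ∑' x, S.indicator (fun x => F x ^ 2) x
      + 2 * r ^ 2 * ∑' x, (F (x + e) - F x) ^ 2 := by
  set A : Lattice d → ℝ := S.indicator (fun x => F x ^ 2) with hA
  set B : Lattice d → ℝ := fun x => (F (x + e) - F x) ^ 2 with hB
  have hsq : Summable fun x => F x ^ 2 := by
    simpa only [sq] using summable_mul_of_finite_support hF F
  have hAs : Summable A := hsq.indicator S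
  have hsq' : Summable fun x => F (x + e) ^ 2 := summable_comp_add hsq e
  have hBs : Summable B := by
    have := (hsq'.add hsq).sub ((summable_mul_of_finite_support hF fun x => F (x + e)).mul_left 2)
    refine this.congr fun x => ?_
    simp only [hB]; ring
  have hA0 : ∀ x, 0 ≤ A x := fun x => Set.indicator_nonneg (fun y _ => sq_nonneg _) x
  have hB0 : ∀ x, 0 ≤ B x := fun x => sq_nonneg _
  -- With `a = F (x + j • e)`, one has `F x ^ 2 ≤ 2 * a ^ 2 + 2 * (a - F x) ^ 2`. Telescoping and
  -- Cauchy–Schwarz bound the increment. Extending both sums to all of `range r` removes the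
  -- dependence of `j` on `x`.
  have key : ∀ x, F x ^ 2 ≤ 2 * (∑ j ∈ Finset.range r, A (x + j • e))
      + 2 * r * ∑ j ∈ Finset.range r, B (x + j • e) := by
    intro x
    obtain ⟨j, hj, hend⟩ := hit x
    have h1 : F (x + j • e) ^ 2 ≤ A (x + j • e) := by
      rcases hend with h | h
      · rw [h]; simpa using hA0 _
      · rw [hA, Set.indicator_of_mem h]
    have h2 : A (x + j • e) ≤ ∑ j ∈ Finset.range r, A (x + j • e) :=
      Finset.single_le_sum (f := fun j => A (x + j • e)) (fun _ _ => hA0 _) (Finset.mem_range.2 hj)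
    have htel : F (x + j • e) - F x
        = ∑ i ∈ Finset.range j, (F (x + i • e + e) - F (x + i • e)) := by
      have := Finset.sum_range_sub (fun i : ℕ => F (x + i • e)) j
      simp only [zero_smul, add_zero] at this
      rw [← this]
      refine Finset.sum_congr rfl fun i _ => ?_
      rw [succ_nsmul, add_assoc]
    have h3 : (F (x + j • e) - F x) ^ 2 ≤ r * ∑ i ∈ Finset.range r, B (x + i • e) := by
      rw [htel]
      calc _ ≤ ((Finset.range j).card : ℝ)
            * ∑ i ∈ Finset.range j, (F (x + i • e + e) - F (x + i • e)) ^ 2 :=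
          sq_sum_le_card_mul_sum_sq
        _ ≤ _ := by
          rw [Finset.card_range]
          have hjr : (j : ℝ) ≤ r := by exact_mod_cast hj.le
          refine mul_le_mul hjr ?_ (Finset.sum_nonneg fun _ _ => sq_nonneg _) (Nat.cast_nonneg r)
          exact Finset.sum_le_sum_of_subset_of_nonneg
            (Finset.range_subset_range.2 hj.le) fun i _ _ => hB0 _
    nlinarith [sq_nonneg (2 * F (x + j • e) - F x)]
  have hsA : ∀ j ∈ Finset.range r, Summable fun x => A (x + j • e) :=
    fun j _ => summable_comp_add hAs _
  have hsB : ∀ j ∈ Finset.range r, Summable fun x => B (x + j • e) :=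
    fun j _ => summable_comp_add hBs _
  have hS1 := (summable_sum hsA).mul_left 2
  have hS2 := (summable_sum hsB).mul_left (2 * (r : ℝ))
  refine (hsq.tsum_le_tsum key (hS1.add hS2)).trans (le_of_eq ?_)
  rw [hS1.tsum_add hS2, tsum_mul_left, tsum_mul_left, Summable.tsum_finsetSum hsA,
    Summable.tsum_finsetSum hsB]
  -- By translation invariance the `r` shifted sums coincide, which produces the factors `2 * r` and
  -- `2 * r ^ 2`.
  simp only [tsum_comp_add, Finset.sum_const, Finset.card_range, nsmul_eq_mul]
  ring

/-! ### The conjugated Laplacian -/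

/-- With `y = η ^ 2 / 2 ≤ 1 / 2`, this is `cosh η ≤ exp y ≤ 1 / (1 - y) ≤ 1 + 2 * y`. -/
theorem cosh_sub_one_le_sq {η : ℝ} (h : |η| ≤ 1) : Real.cosh η - 1 ≤ η ^ 2 := by
  have h1 := Real.cosh_le_exp_half_sq η
  have h2 : η ^ 2 ≤ 1 := by nlinarith [abs_nonneg η, sq_abs η]
  have h3 := Real.add_one_le_exp (-(η ^ 2 / 2))
  have h4 : Real.exp (η ^ 2 / 2) * Real.exp (-(η ^ 2 / 2)) = 1 := by
    rw [← Real.exp_add]; simp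
  have h5 := Real.exp_pos (η ^ 2 / 2)
  nlinarith [mul_le_mul_of_nonneg_left h3 h5.le, sq_nonneg η]

/-- The Laplacian in one direction, conjugated by `exp (η ρ)` with a function `ρ` that varies by at
most one, is bounded below by the Dirichlet form minus `2 η²`. -/
theorem weighted_form_lower_bound {d : ℕ} {F : Lattice d → ℝ} (hF : F.support.Finite)
    (e : Lattice d) {η : ℝ} (hη0 : 0 ≤ η) (hη1 : η ≤ 1) (ρ : Lattice d → ℝ)
    (hρ : ∀ x, |ρ (x + e) - ρ x| ≤ 1) :
    ∑' x, (F (x + e) - F x) ^ 2 - 2 * η ^ 2 * ∑' x, F x ^ 2 ≤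
      ∑' x, F x * (2 * F x - Real.exp (η * (ρ x - ρ (x + e))) * F (x + e)
        - Real.exp (η * (ρ x - ρ (x - e))) * F (x - e)) := by
  have hsq : Summable fun x => F x ^ 2 := by
    simpa only [sq] using summable_mul_of_finite_support hF F
  have hsq' : Summable fun x => F (x + e) ^ 2 := summable_comp_add hsq e
  have hcr := summable_mul_of_finite_support hF fun x => F (x + e)
  set P : Lattice d → ℝ := fun x => F x * (Real.exp (η * (ρ x - ρ (x + e))) * F (x + e)) with hP
  set N : Lattice d → ℝ := fun x => F x * (Real.exp (η * (ρ x - ρ (x - e))) * F (x - e)) with hN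
  have hPs : Summable P := summable_mul_of_finite_support hF _
  have hNs : Summable N := summable_mul_of_finite_support hF _
  have hNs' : Summable fun x => N (x + e) := summable_comp_add hNs e
  -- Shifting the backward term by `e` puts both cross terms on the same bond, where their
  -- exponential weights are reciprocal and add up to `2 * cosh t`.
  have hrhs : ∑' x, F x * (2 * F x - Real.exp (η * (ρ x - ρ (x + e))) * F (x + e)
        - Real.exp (η * (ρ x - ρ (x - e))) * F (x - e))
      = ∑' x, (F x ^ 2 + F (x + e) ^ 2 - P x - N (x + e)) := by
    rw [((hsq.add hsq').sub hPs).tsum_sub hNs', (hsq.add hsq').tsum_sub hPs, hsq.tsum_add hsq',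
      tsum_comp_add N, tsum_comp_add (fun x => F x ^ 2),
      ← hsq.tsum_add hsq, ← (hsq.add hsq).tsum_sub hPs, ← ((hsq.add hsq).sub hPs).tsum_sub hNs]
    refine tsum_congr fun x => ?_
    simp only [hP, hN]; ring
  have hlhs : ∑' x, (F (x + e) - F x) ^ 2 - 2 * η ^ 2 * ∑' x, F x ^ 2
      = ∑' x, ((F (x + e) - F x) ^ 2 - η ^ 2 * (F x ^ 2 + F (x + e) ^ 2)) := by
    have hd : Summable fun x => (F (x + e) - F x) ^ 2 :=
      ((hsq'.add hsq).sub (hcr.mul_left 2)).congr fun x => by ring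
    rw [hd.tsum_sub ((hsq.add hsq').mul_left _), tsum_mul_left, hsq.tsum_add hsq',
      tsum_comp_add (fun x => F x ^ 2)]
    ring
  rw [hrhs, hlhs]
  have hd : Summable fun x => (F (x + e) - F x) ^ 2 :=
    ((hsq'.add hsq).sub (hcr.mul_left 2)).congr fun x => by ring
  refine (hd.sub ((hsq.add hsq').mul_left _)).tsum_le_tsum (fun x => ?_)
    (((hsq.add hsq').sub hPs).sub hNs')
  set t := η * (ρ (x + e) - ρ x) with ht
  have hcosh : P x + N (x + e) = 2 * Real.cosh t * (F x * F (x + e)) := by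
    have e1 : η * (ρ x - ρ (x + e)) = -t := by rw [ht]; ring
    simp only [hP, hN, add_sub_cancel_right, e1, ← ht, Real.cosh_eq]
    ring
  have htabs : |t| ≤ η := by
    rw [ht, abs_mul, abs_of_nonneg hη0]
    exact mul_le_of_le_one_right hη0 (hρ x)
  have h1 : Real.cosh t - 1 ≤ η ^ 2 :=
    (cosh_sub_one_le_sq (htabs.trans hη1)).trans (sq_le_sq' (by linarith [neg_abs_le t])
      ((le_abs_self t).trans htabs))
  have h2 := Real.one_le_cosh t
  have h3 : 2 * (F x * F (x + e)) ≤ F x ^ 2 + F (x + e) ^ 2 := by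
    nlinarith [sq_nonneg (F x - F (x + e))]
  have h4 : (Real.cosh t - 1) * (2 * (F x * F (x + e)))
      ≤ η ^ 2 * (F x ^ 2 + F (x + e) ^ 2) :=
    (mul_le_mul_of_nonneg_left h3 (by linarith)).trans
      (mul_le_mul_of_nonneg_right h1 (by positivity))
  nlinarith

/-! ### The restricted Hamiltonian and its quadratic form -/

theorem hamiltonian_eq_sum {d : ℕ} (u ω : Lattice d → ℝ) {Q : Finset (Lattice d)}
    {g : Lattice d → ℝ} (hg : ∀ x ∉ Q, g x = 0) (x : Lattice d) :
    hamiltonian u ω g x = ∑ y ∈ Q, g y * hamiltonian u ω (Pi.single y 1) x := by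
  have hpt : ∀ n, ∑ y ∈ Q, g y * (Pi.single y (1 : ℝ) : Lattice d → ℝ) n = g n := by
    intro n
    by_cases hn : n ∈ Q
    · rw [Finset.sum_eq_single_of_mem n hn fun y _ hy => by
        rw [Pi.single_eq_of_ne hy.symm, mul_zero], Pi.single_eq_same, mul_one]
    · rw [hg n hn]
      refine Finset.sum_eq_zero fun y hy => ?_
      rw [Pi.single_eq_of_ne (by rintro rfl; exact hn hy), mul_zero]
  simp only [hamiltonian, mul_add, Finset.sum_add_distrib, Finset.mul_sum]
  rw [Finset.sum_comm]
  congr 1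
  · refine Finset.sum_congr rfl fun n _ => ?_
    simp only [mul_sub, Finset.sum_sub_distrib, hpt]
  · simp only [mul_left_comm _ (potential u ω x), ← Finset.mul_sum, hpt]

/-- Extension by zero of a function on a finite set of lattice points. -/
def extendZero {d : ℕ} {Q : Finset (Lattice d)} (ψ : Q → ℝ) (x : Lattice d) : ℝ :=
  if h : x ∈ Q then ψ ⟨x, h⟩ else 0

@[simp] theorem extendZero_coe {d : ℕ} {Q : Finset (Lattice d)} (ψ : Q → ℝ) (x : Q) :
    extendZero ψ x = ψ x := by
  simp [extendZero]

theorem extendZero_of_notMem {d : ℕ} {Q : Finset (Lattice d)} (ψ : Q → ℝ) {x : Lattice d}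
    (h : x ∉ Q) : extendZero ψ x = 0 := by
  simp [extendZero, h]

theorem boxHamiltonian_mulVec {d : ℕ} (u ω : Lattice d → ℝ) (Q : Finset (Lattice d)) (ψ : Q → ℝ)
    (x : Q) :
    (boxHamiltonian u ω Q).mulVec ψ x = hamiltonian u ω (extendZero ψ) x := by
  rw [hamiltonian_eq_sum u ω fun y hy => extendZero_of_notMem ψ hy, ← Finset.sum_coe_sort Q]
  simp only [Matrix.mulVec, dotProduct, boxHamiltonian, Matrix.of_apply, extendZero_coe, mul_comm]

/-- Lower bound for the Hamiltonian conjugated by the weight `exp (η ρ)`. The potential is at least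
`c - a` on `S` and at least `-a` elsewhere, and `S` or the complement of `Q` is met within `r` steps
in the direction `i` from every point of `Q`. -/
theorem weighted_hamiltonian_lower_bound {d : ℕ} (u ω : Lattice d → ℝ) {Q : Finset (Lattice d)}
    {F : Lattice d → ℝ} (hF : ∀ x ∉ Q, F x = 0) (i : Fin d) {S : Set (Lattice d)} {r : ℕ}
    (hr : 0 < r) (hit : ∀ x ∈ Q, ∃ j < r, x + j • unitVec i ∉ Q ∨ x + j • unitVec i ∈ S)
    {c a : ℝ} (hc0 : 0 < c) (hc1 : c ≤ 1)
    (hv : ∀ x ∈ Q, S.indicator (fun _ => c) x - a ≤ potential u ω x)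
    {η : ℝ} (hη0 : 0 ≤ η) (hη1 : η ≤ 1) (ρ : Lattice d → ℝ)
    (hρ : ∀ i x, |ρ (x + unitVec i) - ρ x| ≤ 1) :
    (c / (2 * r ^ 2) - a - 2 * d * η ^ 2) * ∑' x, F x ^ 2 ≤
      ∑ x ∈ Q, F x * (Real.exp (η * ρ x) *
        hamiltonian u ω (fun y => Real.exp (-(η * ρ y)) * F y) x) := by
  have hfin : F.support.Finite := Q.finite_toSet.subset fun x hx => by
    by_contra h
    exact hx (hF x h)
  have hsq : Summable fun x => F x ^ 2 := by
    simpa only [sq] using summable_mul_of_finite_support hfin F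
  set L : Fin d → Lattice d → ℝ := fun k x =>
    F x * (2 * F x - Real.exp (η * (ρ x - ρ (x + unitVec k))) * F (x + unitVec k)
        - Real.exp (η * (ρ x - ρ (x - unitVec k))) * F (x - unitVec k)) with hL
  have hLs : ∀ k, Summable (L k) := fun k => summable_mul_of_finite_support hfin _
  have hexpand : ∀ x, F x * (Real.exp (η * ρ x) *
        hamiltonian u ω (fun y => Real.exp (-(η * ρ y)) * F y) x)
      = ∑ k, L k x + F x * (potential u ω x * F x) := by
    intro x
    have hone : Real.exp (η * ρ x) * Real.exp (-(η * ρ x)) = 1 := by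
      rw [← Real.exp_add]; simp
    have hmul : ∀ y, Real.exp (η * (ρ x - ρ y)) = Real.exp (η * ρ x) * Real.exp (-(η * ρ y)) := by
      intro y
      rw [← Real.exp_add]; congr 1; ring
    rw [hamiltonian, sum_neighbors, mul_add, mul_add, Finset.mul_sum, Finset.mul_sum]
    congr 1
    · refine Finset.sum_congr rfl fun k _ => ?_
      simp only [hL, hmul]
      linear_combination (2 * F x ^ 2) * hone
    · linear_combination (potential u ω x * F x ^ 2) * hone
  have hVs : Summable fun x => F x * (potential u ω x * F x) :=
    summable_mul_of_finite_support hfin _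
  have hsum : ∑ x ∈ Q, F x * (Real.exp (η * ρ x) *
        hamiltonian u ω (fun y => Real.exp (-(η * ρ y)) * F y) x)
      = ∑ k, ∑' x, L k x + ∑' x, F x * (potential u ω x * F x) := by
    rw [← tsum_eq_sum (L := SummationFilter.unconditional _) (s := Q)
      fun x hx => by rw [hF x hx, zero_mul]]
    simp only [hexpand]
    rw [(summable_sum fun k _ => hLs k).tsum_add hVs, Summable.tsum_finsetSum fun k _ => hLs k]
  set D : Fin d → ℝ := fun k => ∑' x, (F (x + unitVec k) - F x) ^ 2 with hD
  have hD0 : ∀ k, 0 ≤ D k := fun k => tsum_nonneg fun x => sq_nonneg _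
  have hLb : ∑ k, (D k - 2 * η ^ 2 * ∑' x, F x ^ 2) ≤ ∑ k, ∑' x, L k x :=
    Finset.sum_le_sum fun k _ => weighted_form_lower_bound hfin _ hη0 hη1 ρ (hρ k)
  -- The Poincaré inequality uses a single direction; the Dirichlet forms in the others are
  -- discarded. The conjugation error is paid in all `d` directions.
  have hDi : D i ≤ ∑ k, D k := Finset.single_le_sum (fun k _ => hD0 k) (Finset.mem_univ i)
  rw [Finset.sum_sub_distrib, Finset.sum_const, Finset.card_univ, Fintype.card_fin,
    nsmul_eq_mul] at hLb
  have hAs : Summable (S.indicator fun x => F x ^ 2) := hsq.indicator S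
  have hVb : c * ∑' x, S.indicator (fun x => F x ^ 2) x - a * ∑' x, F x ^ 2
      ≤ ∑' x, F x * (potential u ω x * F x) := by
    rw [← tsum_mul_left, ← tsum_mul_left, ← (hAs.mul_left c).tsum_sub (hsq.mul_left a)]
    refine ((hAs.mul_left c).sub (hsq.mul_left a)).tsum_le_tsum (fun x => ?_) hVs
    by_cases hx : x ∈ Q
    · have h1 := mul_le_mul_of_nonneg_left (hv x hx) (sq_nonneg (F x))
      by_cases hS : x ∈ S
      · simp only [Set.indicator_of_mem hS] at h1 ⊢
        linarith
      · simp only [Set.indicator_of_notMem hS] at h1 ⊢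
        linarith
    · by_cases hS : x ∈ S <;> simp [hF x hx, hS]
  have hP := tsum_sq_le_of_hits hfin (unitVec i) S r (fun x => by
    by_cases hx : x ∈ Q
    · obtain ⟨j, hj, h⟩ := hit x hx
      exact ⟨j, hj, h.imp_left (hF _)⟩
    · exact ⟨0, hr, Or.inl (by simpa using hF x hx)⟩)
  have hA0 : 0 ≤ ∑' x, S.indicator (fun x => F x ^ 2) x :=
    tsum_nonneg fun x => Set.indicator_nonneg (fun y _ => sq_nonneg _) x
  have hr1 : (1 : ℝ) ≤ r := by exact_mod_cast hr
  -- Here `r ≤ r ^ 2` and `c ≤ 1` bring both Poincaré constants, after multiplication by `c`, under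
  -- the common factor `2 * r ^ 2`.
  have hmain : c / (2 * r ^ 2) * ∑' x, F x ^ 2
      ≤ c * ∑' x, S.indicator (fun x => F x ^ 2) x + D i := by
    rw [div_mul_eq_mul_div, div_le_iff₀ (by positivity)]
    have h1 : (r : ℝ) ≤ r ^ 2 := by nlinarith
    have h2 := mul_le_mul_of_nonneg_left hP hc0.le
    have h3 := mul_le_mul_of_nonneg_right h1 (mul_nonneg hc0.le hA0)
    have h4 := mul_le_mul_of_nonneg_right hc1 (mul_nonneg (sq_nonneg (r : ℝ)) (hD0 i))
    simp only [hD] at h4 ⊢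
    nlinarith
  rw [hsum]
  linarith

/-! ### From coercivity to decay of the Green's function -/

/-- Combes–Thomas estimate at the bottom of the spectrum: under the hypotheses of the lower bound
for the conjugated Hamiltonian, a cube is regular. -/
theorem isRegular_of_hits {d : ℕ} (u ω : Lattice d → ℝ) (z : Lattice d) (l : ℕ)
    (i : Fin d) {S : Set (Lattice d)} {r : ℕ} (hr : 0 < r)
    (hit : ∀ x ∈ box z l, ∃ j < r, x + j • unitVec i ∉ box z l ∨ x + j • unitVec i ∈ S)
    {c a : ℝ} (hc0 : 0 < c) (hc1 : c ≤ 1)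
    (hv : ∀ x ∈ box z l, S.indicator (fun _ => c) x - a ≤ potential u ω x)
    {η E γ m : ℝ} (hη0 : 0 ≤ η) (hη1 : η ≤ 1) (hγ0 : 0 < γ)
    (hγ : γ ≤ c / (2 * r ^ 2) - a - 2 * d * η ^ 2 - E)
    (hm : Real.exp ((m - η) * l) ≤ γ) :
    IsRegular u z l m E ω := by
  set Q := box z l with hQ
  set A := boxHamiltonian u ω Q - E • (1 : Matrix Q Q ℝ) with hA
  -- The weight is centered at an arbitrary `w`: any center gives invertibility, and the boundary
  -- point gives decay of the column of the inverse based there.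
  have coercive : ∀ (ψ : Q → ℝ) (w : Lattice d),
      γ * ∑ x : Q, (Real.exp (η * ‖(x : Lattice d) - w‖) * ψ x) ^ 2
        ≤ ∑ x : Q, Real.exp (η * ‖(x : Lattice d) - w‖) ^ 2 * ψ x * A.mulVec ψ x := by
    intro ψ w
    set ρ : Lattice d → ℝ := fun x => ‖x - w‖ with hρ
    set F : Lattice d → ℝ := fun x => Real.exp (η * ρ x) * extendZero ψ x with hF
    have hF0 : ∀ x ∉ Q, F x = 0 := fun x hx => by
      simp only [hF, extendZero_of_notMem ψ hx, mul_zero]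
    have hρ1 : ∀ i x, |ρ (x + unitVec i) - ρ x| ≤ 1 := by
      intro i x
      refine (abs_norm_sub_norm_le _ _).trans ?_
      rw [sub_sub_sub_cancel_right, add_sub_cancel_left]
      exact norm_unitVec_le i
    have hone : ∀ x, Real.exp (-(η * ρ x)) * Real.exp (η * ρ x) = 1 := by
      intro x
      rw [← Real.exp_add]; simp
    have hback : (fun y => Real.exp (-(η * ρ y)) * F y) = extendZero ψ := by
      funext y
      simp only [hF]
      rw [← mul_assoc, hone, one_mul]
    have h := weighted_hamiltonian_lower_bound u ω hF0 i hr hit hc0 hc1 hv hη0 hη1 ρ hρ1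
    rw [hback, tsum_eq_sum (s := Q) (fun x hx => by rw [hF0 x hx]; simp), ← Finset.sum_coe_sort Q,
      ← Finset.sum_coe_sort Q] at h
    have hA' : ∀ x, A.mulVec ψ x = hamiltonian u ω (extendZero ψ) x - E * ψ x := by
      intro x
      rw [hA, Matrix.sub_mulVec, Pi.sub_apply, boxHamiltonian_mulVec, Matrix.smul_mulVec,
        Matrix.one_mulVec, Pi.smul_apply, smul_eq_mul]
    have hrw : ∑ x : Q, Real.exp (η * ‖(x : Lattice d) - w‖) ^ 2 * ψ x * A.mulVec ψ x
        = ∑ x : Q, F x * (Real.exp (η * ρ x) * hamiltonian u ω (extendZero ψ) x)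
          - E * ∑ x : Q, F x ^ 2 := by
      rw [Finset.mul_sum, ← Finset.sum_sub_distrib]
      refine Finset.sum_congr rfl fun x _ => ?_
      rw [hA']
      simp only [hF, hρ, extendZero_coe]
      ring
    have hsq : ∑ x : Q, (Real.exp (η * ‖(x : Lattice d) - w‖) * ψ x) ^ 2 = ∑ x : Q, F x ^ 2 := by
      simp only [hF, hρ, extendZero_coe]
    rw [hrw, hsq]
    have h0 : 0 ≤ ∑ x : Q, F x ^ 2 := Finset.sum_nonneg fun x _ => sq_nonneg _
    nlinarith [mul_le_mul_of_nonneg_right hγ h0]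
  have hunit : IsUnit A := by
    rw [← Matrix.mulVec_injective_iff_isUnit]
    refine (injective_iff_map_eq_zero A.mulVecLin).2 fun ψ hψ => ?_
    have h := coercive ψ z
    have hψ' : A.mulVec ψ = 0 := hψ
    simp only [hψ', Pi.zero_apply, mul_zero, Finset.sum_const_zero] at h
    have hz : ∑ x : Q, (Real.exp (η * ‖(x : Lattice d) - z‖) * ψ x) ^ 2 = 0 :=
      le_antisymm (nonpos_of_mul_nonpos_right h hγ0) (Finset.sum_nonneg fun x _ => sq_nonneg _)
    funext x
    have hx := (Finset.sum_eq_zero_iff_of_nonneg fun x _ => sq_nonneg _).1 hz x (Finset.mem_univ x)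
    simpa [(Real.exp_pos _).ne'] using hx
  refine ⟨?_, fun w hw => ?_⟩
  · rw [spectrum.mem_iff, not_not, Algebra.algebraMap_eq_smul_one, ← neg_sub]
    exact hunit.neg
  · have hdist := le_norm_sub_of_mem_innerBoundary hw
    set G : Q → ℝ := fun x => A⁻¹ x w with hG
    set zq : Q := ⟨z, center_mem_box z l⟩ with hzq
    have hAG : A.mulVec G = Pi.single w 1 := by
      have h1 : A * A⁻¹ = 1 := Matrix.mul_nonsing_inv A ((Matrix.isUnit_iff_isUnit_det A).1 hunit)
      funext x
      have h2 := congrFun (congrFun h1 x) w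
      rw [Matrix.one_apply] at h2
      rw [Pi.single_apply, ← h2]
      rfl
    have h := coercive G w
    -- Since `A G` is the delta function at `w`, where the weight is one, the form collapses to `G
    -- w`.
    have hr : ∑ x : Q, Real.exp (η * ‖(x : Lattice d) - w‖) ^ 2 * G x * A.mulVec G x = G w := by
      rw [Finset.sum_eq_single w (fun x _ hx => by rw [hAG, Pi.single_eq_of_ne hx, mul_zero])
        (by simp), hAG]
      simp
    rw [hr] at h
    have hterm : ∀ y : Q, γ * (Real.exp (η * ‖(y : Lattice d) - w‖) * G y) ^ 2 ≤ G w := by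
      intro y
      refine le_trans (mul_le_mul_of_nonneg_left ?_ hγ0.le) h
      exact Finset.single_le_sum
        (f := fun x : Q => (Real.exp (η * ‖(x : Lattice d) - w‖) * G x) ^ 2)
        (fun x _ => sq_nonneg _) (Finset.mem_univ y)
    have hw1 := hterm w
    simp only [sub_self, norm_zero, mul_zero, Real.exp_zero, one_mul] at hw1
    have hGw0 : 0 ≤ G w := le_trans (by positivity) hw1
    have hGw : γ * G w ≤ 1 := by
      by_contra! hlt
      have hpos : 0 < G w := by
        rcases hGw0.eq_or_lt with h0 | h0
        · rw [← h0] at hlt; linarith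
        · exact h0
      nlinarith
    have hz1 := hterm zq
    set M := Real.exp (η * ‖(zq : Lattice d) - w‖) with hM
    have hM0 : 0 < M := Real.exp_pos _
    -- Coercivity gives `γ * (M * G zq) ^ 2 ≤ G w`, and the diagonal entry satisfies `γ * G w ≤ 1`.
    have hz2 : (γ * (M * |G zq|)) ^ 2 ≤ 1 := by
      have : (γ * (M * |G zq|)) ^ 2 = γ * (γ * (M * G zq) ^ 2) := by
        rw [mul_pow, mul_pow, sq_abs]; ring
      rw [this]
      exact (mul_le_mul_of_nonneg_left hz1 hγ0.le).trans hGw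
    have hz3 : γ * (M * |G zq|) ≤ 1 := by
      refine (sq_le_one_iff₀ ?_).1 hz2
      positivity
    have hMl : Real.exp (η * l) ≤ M :=
      Real.exp_le_exp.2 (mul_le_mul_of_nonneg_left hdist hη0)
    change |G zq| ≤ Real.exp (-m * l)
    have hprod : Real.exp ((m - η) * l) * Real.exp (η * l) ≤ γ * M :=
      mul_le_mul hm hMl (Real.exp_pos _).le hγ0.le
    rw [← Real.exp_add] at hprod
    have hexp : (m - η) * l + η * l = -(-m * l) := by ring
    rw [hexp, Real.exp_neg] at hprod
    have h5 : (Real.exp (-m * l))⁻¹ * |G zq| ≤ 1 := by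
      refine (mul_le_mul_of_nonneg_right hprod (abs_nonneg _)).trans ?_
      rwa [mul_assoc]
    rwa [inv_mul_le_iff₀ (Real.exp_pos _), mul_one] at h5

/-! ### The single-site potential -/

/-- The weight factorizes over coordinates into geometric series. It gives a majorant common to all
admissible `u`. -/
theorem summable_exp_neg_mul_l1Norm (d : ℕ) {α : ℝ} (hα : 0 < α) :
    Summable fun k : Lattice d => Real.exp (-α * (l1Norm k : ℝ)) := by
  have hone : Summable fun n : ℤ => Real.exp (-α * (|n| : ℤ)) := by
    have hnat : Summable fun n : ℕ => Real.exp (n * -α) :=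
      Real.summable_exp_nat_mul_iff.2 (neg_lt_zero.2 hα)
    refine Summable.of_nat_of_neg (hnat.congr fun n => ?_) (hnat.congr fun n => ?_) <;>
      simp [mul_comm]
  induction d with
  | zero => exact (hasSum_fintype _).summable
  | succ n ih =>
    rw [← (Fin.consEquiv fun _ => ℤ).summable_iff]
    refine (hone.mul_of_nonneg ih (fun _ => (Real.exp_pos _).le)
      fun _ => (Real.exp_pos _).le).congr fun p => ?_
    simp only [Function.comp_apply, Fin.consEquiv_apply, l1Norm, Fin.sum_univ_succ, Fin.cons_zero,
      Fin.cons_succ]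
    rw [← Real.exp_add]
    push_cast
    congr 1
    ring

/-- Functions dominated by a fixed summable function and with a given positive sum are bounded below
by a fixed positive number at some point of a fixed finite set. -/
theorem exists_finset_forall_exists_le {ι : Type*} {b : ι → ℝ} (hb : Summable b) {s : ℝ}
    (hs : 0 < s) :
    ∃ T : Finset ι, ∃ c > 0, ∀ u : ι → ℝ, (∀ k, |u k| ≤ b k) → ∑' k, u k = s →
      ∃ k ∈ T, c ≤ u k := by
  obtain ⟨T, hT⟩ := (Filter.Tendsto.eventually_const_lt
    (show ∑' k, b k - s / 2 < ∑' k, b k by linarith) hb.hasSum).exists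
  -- Outside `T` the majorant sums to less than `s / 2`. If `u` were below this threshold throughout
  -- `T`, the sites of `T` would contribute at most `s / 2`. The `+ 1` allows an empty `T`.
  refine ⟨T, s / (2 * (T.card + 1)), by positivity, fun u hu hsum => ?_⟩
  by_contra! hlt
  have hus : Summable u := Summable.of_norm_bounded hb hu
  have h1 := hus.sum_add_tsum_compl (s := T)
  have h2 := hb.sum_add_tsum_compl (s := T)
  have h3 : ∑' k : ((T : Set ι)ᶜ : Set ι), u k ≤ ∑' k : ((T : Set ι)ᶜ : Set ι), b k :=
    (hus.subtype _).tsum_le_tsum (fun k => (le_abs_self _).trans (hu k)) (hb.subtype _)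
  have h4 : ∑ k ∈ T, u k ≤ T.card * (s / (2 * (T.card + 1))) := by
    rw [← nsmul_eq_mul]
    exact Finset.sum_le_card_nsmul _ _ _ fun k hk => (hlt k hk).le
  have h5 : T.card * (s / (2 * ((T.card : ℝ) + 1))) ≤ s / 2 := by
    rw [mul_div_assoc', div_le_div_iff₀ (by positivity) (by positivity)]
    nlinarith [hs]
  linarith

/-- The potential is bounded below by the contribution of one positive site, up to the negative
part. -/
theorem le_potential {d : ℕ} {u v ω : Lattice d → ℝ} (hu : Summable u) (hv : Summable v)
    (hv0 : ∀ k, 0 ≤ v k) (hv1 : ∑' k, v k ≤ 1) {δ W : ℝ} (hδ : 0 ≤ δ)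
    (huv : ∀ k, -(δ * v k) ≤ u k) (hω : ∀ k, ω k ∈ Set.Icc 0 W) {k₀ : Lattice d} {c : ℝ}
    (hc : c ≤ u k₀) (x : Lattice d) :
    c * ω (x - k₀) - δ * W ≤ potential u ω x := by
  have hW : 0 ≤ W := (hω 0).1.trans (hω 0).2
  have hu' : Summable fun k => u (x - k) := (Equiv.subLeft x).summable_iff.2 hu
  have hv' : Summable fun k => v (x - k) := (Equiv.subLeft x).summable_iff.2 hv
  have hvs : ∑' k, v (x - k) = ∑' k, v k := (Equiv.subLeft x).tsum_eq v
  have hsum : Summable fun k => ω k * u (x - k) := by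
    refine Summable.of_norm_bounded (hu'.norm.mul_left W) fun k => ?_
    rw [norm_mul, Real.norm_of_nonneg (hω k).1]
    exact mul_le_mul_of_nonneg_right (hω k).2 (norm_nonneg _)
  have hpt : ∀ k, (Pi.single (x - k₀) (c * ω (x - k₀)) : Lattice d → ℝ) k
      - δ * W * v (x - k) ≤ ω k * u (x - k) := by
    intro k
    have hn : 0 ≤ δ * W * v (x - k) := mul_nonneg (mul_nonneg hδ hW) (hv0 _)
    by_cases hk : k = x - k₀
    · subst hk
      rw [Pi.single_eq_same]
      have := mul_le_mul_of_nonneg_right hc (hω (x - k₀)).1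
      rw [sub_sub_cancel] at hn ⊢
      linarith
    · rw [Pi.single_eq_of_ne hk]
      have h1 := mul_le_mul_of_nonneg_left (huv (x - k)) (hω k).1
      have h2 := mul_le_mul_of_nonneg_right (hω k).2 (mul_nonneg hδ (hv0 (x - k)))
      linarith
  have hs1 := hasSum_pi_single (x - k₀) (c * ω (x - k₀))
  have hs2 := (hv'.mul_left (δ * W)).hasSum
  rw [tsum_mul_left, hvs] at hs2
  have h := hasSum_le hpt (hs1.sub hs2) hsum.hasSum
  refine le_trans ?_ h
  have := mul_le_mul_of_nonneg_left hv1 (mul_nonneg hδ hW)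
  linarith

/-! ### The probability of long segments of small couplings -/

theorem couplingLaw_forall_lt_le {d : ℕ} (μ : Measure ℝ) [IsProbabilityMeasure μ] {t : ℝ}
    {p : ENNReal} (hμ : couplingLaw d μ {ω | ω 0 < t} ≤ p) (T : Finset (Lattice d)) :
    couplingLaw d μ {ω | ∀ k ∈ T, ω k < t} ≤ p ^ T.card := by
  have hpi : ∀ T : Finset (Lattice d),
      couplingLaw d μ {ω | ∀ k ∈ T, ω k < t} = μ (Set.Iio t) ^ T.card := by
    intro T
    have hset : {ω : Lattice d → ℝ | ∀ k ∈ T, ω k < t}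
        = Set.pi (T : Set (Lattice d)) fun _ => Set.Iio t := by
      ext ω; simp
    rw [hset, couplingLaw, Measure.infinitePi_pi _ fun _ _ => measurableSet_Iio, Finset.prod_const]
  -- The one-site case turns the hypothesis on the coupling at the origin into a bound on `μ`.
  have h0 := hpi {0}
  simp only [Finset.mem_singleton, forall_eq, Finset.card_singleton, pow_one] at h0
  rw [hpi, ← h0]
  exact pow_le_pow_left' hμ _

theorem card_box {d : ℕ} (z : Lattice d) (l : ℕ) : (box z l).card = (2 * l + 1) ^ d := by
  rw [box, Pi.card_Icc]
  have : ∀ i, (Finset.Icc (z i - (l : ℤ)) (z i + (l : ℤ))).card = 2 * l + 1 := by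
    intro i
    rw [Int.card_Icc]
    omega
  simp [this]

/-- A union bound over starting points; the `r` sites of a segment are distinct, hence independent.
-/
theorem couplingLaw_exists_segment_le {d : ℕ} (μ : Measure ℝ) [IsProbabilityMeasure μ] {t : ℝ}
    {p : ENNReal} (hμ : couplingLaw d μ {ω | ω 0 < t} ≤ p) (z k₀ : Lattice d) (i : Fin d)
    (l r : ℕ) :
    couplingLaw d μ {ω | ∃ x ∈ box z l, ∀ j < r, ω (x + j • unitVec i - k₀) < t}
      ≤ ((2 * l + 1 : ℕ) : ENNReal) ^ d * p ^ r := by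
  have hset : {ω : Lattice d → ℝ | ∃ x ∈ box z l, ∀ j < r, ω (x + j • unitVec i - k₀) < t}
      = ⋃ x ∈ box z l, {ω | ∀ j < r, ω (x + j • unitVec i - k₀) < t} := by
    ext ω; simp
  rw [hset]
  refine (measure_biUnion_finset_le _ _).trans ?_
  have hone : ∀ x ∈ box z l,
      couplingLaw d μ {ω | ∀ j < r, ω (x + j • unitVec i - k₀) < t} ≤ p ^ r := by
    intro x _
    have hinj : Function.Injective fun j : ℕ => x + j • unitVec i - k₀ := by
      intro j k hjk
      have := congrFun hjk i
      simpa using this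
    have h := couplingLaw_forall_lt_le μ hμ ((Finset.range r).image fun j => x + j • unitVec i - k₀)
    rw [Finset.card_image_of_injective _ hinj, Finset.card_range] at h
    simpa using h
  refine (Finset.sum_le_card_nsmul _ _ _ hone).trans_eq ?_
  rw [card_box, nsmul_eq_mul]
  push_cast
  rfl

/-! ### Choice of the length scales -/

open Filter Topology in
/-- Polynomially related lengths `r` and `l = r ^ N` for which every requirement of the initial
scale estimate with mass `c / r` is met. -/
theorem exists_scales (d : ℕ) {ξ κ β q : ℝ} (hpar : AdmissibleParameters d ξ κ β q) (lstar R : ℝ)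
    {c g : ℝ} (hc0 : 0 < c) (hc1 : c ≤ 1) (hg : 0 < g) :
    ∃ r l : ℕ, 0 < r ∧ 1 < l ∧ lstar ≤ (l : ℝ) ∧ R ≤ (l : ℝ) ∧
      massLossScale β κ q (c / r) ≤ (l : ℝ) ∧ (l : ℝ) ^ (β - 1) < c / r ∧
      Real.exp (-(c / r) * l) ≤ g / r ^ 2 ∧
      (2 * (l : ℝ) + 1) ^ d * (1 / 12) ^ r ≤ (l : ℝ) ^ (-2 * ξ) := by
  have hβ : 0 < 1 - β := sub_pos.2 hpar.beta_lt_one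
  have hκ := hpar.one_lt_kappa
  have hq : 0 < 1 - q := sub_pos.2 hpar.q_lt_one
  have hq0 := hpar.q_pos
  set p := κ / (1 - β) with hp
  have hp0 : 0 < p := div_pos (by linarith) hβ
  -- The mass loss scale grows like `r ^ p`, so `N > p` beats it. As `κ > 1`, also `N * (1 - β) >
  -- 1`, which gives `l ^ (β - 1) < c / r`. Finally `N ≥ 2` makes `(c / r) * l ≥ c * r`.
  obtain ⟨N, hN⟩ := exists_nat_gt (max p 2)
  have hNp : p < N := (le_max_left _ _).trans_lt hN
  have hN2 : (2 : ℝ) < N := (le_max_right _ _).trans_lt hN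
  have hN2' : 2 ≤ N := by exact_mod_cast hN2.le
  have hNβ : 1 < N * (1 - β) := by
    rw [hp, div_lt_iff₀ hβ] at hNp
    linarith
  set K : ℝ := (3 / ((1 - q) * c)) ^ p with hK
  have hcast : Tendsto (fun r : ℕ => (r : ℝ)) atTop atTop := tendsto_natCast_atTop_atTop
  have e1 : ∀ᶠ r : ℕ in atTop, lstar ≤ (r : ℝ) := hcast.eventually_ge_atTop _
  have e2 : ∀ᶠ r : ℕ in atTop, R ≤ (r : ℝ) := hcast.eventually_ge_atTop _
  have e3 : ∀ᶠ r : ℕ in atTop, K ≤ (r : ℝ) ^ (N - p) :=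
    ((tendsto_rpow_atTop (sub_pos.2 hNp)).comp hcast).eventually_ge_atTop _
  have e4 : ∀ᶠ r : ℕ in atTop, (r : ℝ) ^ (-(N * (1 - β) - 1)) < c :=
    ((tendsto_rpow_neg_atTop (sub_pos.2 hNβ)).comp hcast).eventually_lt_const hc0
  have e5 : ∀ᶠ r : ℕ in atTop, (r : ℝ) ^ (2 : ℝ) * Real.exp (-c * r) < g :=
    ((tendsto_rpow_mul_exp_neg_mul_atTop_nhds_zero 2 c hc0).comp hcast).eventually_lt_const hg
  have hlog : 0 < Real.log 12 := Real.log_pos (by norm_num)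
  have e6 : ∀ᶠ r : ℕ in atTop,
      (r : ℝ) ^ (N * d + 2 * ξ * N) * Real.exp (-Real.log 12 * r) < ((3 : ℝ) ^ d)⁻¹ :=
    ((tendsto_rpow_mul_exp_neg_mul_atTop_nhds_zero _ _ hlog).comp hcast).eventually_lt_const
      (by positivity)
  obtain ⟨r, h1, h2, h3, h4, h5, h6, h7⟩ := (e1.and (e2.and (e3.and (e4.and (e5.and
    (e6.and (eventually_ge_atTop 2))))))).exists
  have hr1 : (1 : ℝ) ≤ r := by exact_mod_cast (by omega : 1 ≤ r)
  have hr0 : (0 : ℝ) < r := by linarith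
  have hrN : r ≤ r ^ N := Nat.le_self_pow (by omega) r
  have hrN' : (r : ℝ) ≤ ((r ^ N : ℕ) : ℝ) := by exact_mod_cast hrN
  have hpow : ((r ^ N : ℕ) : ℝ) = (r : ℝ) ^ (N : ℝ) := by rw [Real.rpow_natCast]; push_cast; rfl
  refine ⟨r, r ^ N, by omega, by omega, h1.trans hrN', h2.trans hrN', ?_, ?_, ?_, ?_⟩
  · have hm0 : 0 < c / r := div_pos hc0 hr0
    have hm1 : c / r ≤ 1 := (div_le_one hr0).2 (hc1.trans hr1)
    -- The denominator is at most `3`, because `1 - q` and `c / r` are at most one.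
    have hbase : (3 / ((1 - q) * c) * r)⁻¹
        ≤ (1 - q) * (c / r) / ((1 - q) * (c / r) + c / r + 1) := by
      have hA : (3 / ((1 - q) * c) * r)⁻¹ = (1 - q) * (c / r) / 3 := by
        field_simp
      rw [hA]
      refine div_le_div_of_nonneg_left (by positivity) (by positivity) ?_
      nlinarith
    have hpos : 0 < 3 / ((1 - q) * c) * r := by positivity
    rw [massLossScale, neg_div, ← hp]
    refine (Real.rpow_le_rpow_of_nonpos (inv_pos.2 hpos) hbase (neg_nonpos.2 hp0.le)).trans ?_
    rw [Real.rpow_neg (inv_pos.2 hpos).le, Real.inv_rpow hpos.le, inv_inv,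
      Real.mul_rpow (by positivity) hr0.le, ← hK, hpow]
    calc K * (r : ℝ) ^ p ≤ (r : ℝ) ^ (N - p) * (r : ℝ) ^ p :=
          mul_le_mul_of_nonneg_right h3 (Real.rpow_nonneg hr0.le _)
      _ = (r : ℝ) ^ (N : ℝ) := by rw [← Real.rpow_add hr0]; congr 1; ring
  · rw [hpow, ← Real.rpow_mul hr0.le, lt_div_iff₀ hr0]
    calc (r : ℝ) ^ ((N : ℝ) * (β - 1)) * r = (r : ℝ) ^ ((N : ℝ) * (β - 1)) * (r : ℝ) ^ (1 : ℝ) := by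
          rw [Real.rpow_one]
      _ = (r : ℝ) ^ (-(N * (1 - β) - 1)) := by rw [← Real.rpow_add hr0]; congr 1; ring
      _ < c := h4
  · rw [le_div_iff₀ (by positivity), mul_comm, ← Real.rpow_natCast]
    refine le_trans (mul_le_mul_of_nonneg_left (Real.exp_le_exp.2 ?_) (by positivity)) h5.le
    have hr2 : (r : ℝ) ^ 2 ≤ ((r ^ N : ℕ) : ℝ) := by
      push_cast
      exact pow_le_pow_right₀ hr1 hN2'
    have := mul_le_mul_of_nonneg_left hr2 (div_pos hc0 hr0).le
    have h8 : c / r * (r : ℝ) ^ 2 = c * r := by field_simp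
    linarith
  · have hl1 : (1 : ℝ) ≤ ((r ^ N : ℕ) : ℝ) := hr1.trans hrN'
    have hl0 : (0 : ℝ) < ((r ^ N : ℕ) : ℝ) := by linarith
    have ha : (2 * ((r ^ N : ℕ) : ℝ) + 1) ^ d ≤ 3 ^ d * (r : ℝ) ^ ((N : ℝ) * d) := by
      rw [Real.rpow_mul hr0.le, ← hpow, Real.rpow_natCast, ← mul_pow]
      exact pow_le_pow_left₀ (by positivity) (by linarith) _
    have hb : ((1 : ℝ) / 12) ^ r = Real.exp (-Real.log 12 * r) := by
      rw [mul_comm, Real.exp_nat_mul, Real.exp_neg, Real.exp_log (by norm_num), one_div]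
    have hξ : ((r ^ N : ℕ) : ℝ) ^ (-2 * ξ) = (r : ℝ) ^ (-(2 * ξ * N)) := by
      rw [hpow, ← Real.rpow_mul hr0.le]; congr 1; ring
    rw [hb, hξ, Real.rpow_neg hr0.le]
    rw [Real.rpow_add hr0] at h6
    have hX : 0 < (r : ℝ) ^ (2 * ξ * N) := Real.rpow_pos_of_pos hr0 _
    rw [← one_div ((3 : ℝ) ^ d), lt_div_iff₀ (by positivity)] at h6
    rw [← one_div, le_div_iff₀ hX]
    have hE := Real.exp_pos (-Real.log 12 * r)
    calc _ ≤ 3 ^ d * (r : ℝ) ^ ((N : ℝ) * d) * Real.exp (-Real.log 12 * r)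
          * (r : ℝ) ^ (2 * ξ * N) := by gcongr
      _ ≤ 1 := by linarith

/-! ### Uniform regularity and conclusion -/

/-- If every segment of length `r` in the direction `i` starting in the cube of radius `l` contains
a large coupling constant (after the shift by a site `k₀` with `c₀ ≤ u k₀`), then the cube is
uniformly regular near energy zero. -/
theorem isUniformlyRegular_of_segments {d : ℕ} (μ : Measure ℝ) {u v ω : Lattice d → ℝ}
    (hu : Summable u) (hv : Summable v) (hv0 : ∀ k, 0 ≤ v k) (hv1 : ∑' k, v k ≤ 1) {δ W : ℝ}
    (hδ : 0 ≤ δ) (huv : ∀ k, -(δ * v k) ≤ u k) (hW : μ.support = Set.Icc 0 W)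
    {k₀ : Lattice d} {l r : ℕ} (hk₀ : ∀ i, |k₀ i| ≤ l) {c₀ t c : ℝ} (hc₀ : 0 < c₀) (hck : c₀ ≤ u k₀)
    (hc0 : 0 < c) (hc1 : c ≤ 1) (hct : c ≤ c₀ * t) (i : Fin d) (hr : 0 < r) (z : Lattice d)
    (hseg : ∀ x ∈ box z l, ∃ j < r, t ≤ ω (x + j • unitVec i - k₀))
    {η E γ m : ℝ} (hη0 : 0 ≤ η) (hη1 : η ≤ 1) (hγ0 : 0 < γ)
    (hγ : γ ≤ c / (2 * r ^ 2) - δ * W - 2 * d * η ^ 2 - E)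
    (hm : Real.exp ((m - η) * l) ≤ γ) :
    IsUniformlyRegular μ u z l m E ω := by
  intro ω' hω' hagree
  have hωI : ∀ k, ω' k ∈ Set.Icc 0 W := fun k => hW ▸ hω' k
  refine isRegular_of_hits u ω' z l i (S := {y | t ≤ ω' (y - k₀)}) hr (fun x hx => ?_) hc0 hc1
    (fun x _ => ?_) hη0 hη1 hγ0 hγ hm
  · obtain ⟨j, hj, h⟩ := hseg x hx
    refine ⟨j, hj, ?_⟩
    -- A segment that leaves the cube meets a zero of the extended function. Otherwise the relevant
    -- site is within `l + l ≤ 4l` of `z`, where `ω'` and `ω` agree.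
    by_cases hy : x + j • unitVec i ∈ box z l
    · right
      rw [Set.mem_ofPred_eq, hagree]
      · exact h
      · rw [mem_box] at hy ⊢
        intro a
        have h1 := abs_le.1 (hy a)
        have h2 := abs_le.1 (hk₀ a)
        rw [Pi.sub_apply, abs_le]
        push_cast
        constructor <;> linarith [h1.1, h1.2, h2.1, h2.2]
    · exact Or.inl hy
  · refine le_trans (sub_le_sub_right ?_ _) (le_potential hu hv hv0 hv1 hδ huv hωI hck x)
    by_cases hx : x ∈ {y | t ≤ ω' (y - k₀)}
    · rw [Set.indicator_of_mem hx]
      exact hct.trans (mul_le_mul_of_nonneg_left hx hc₀.le)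
    · rw [Set.indicator_of_notMem hx]
      exact mul_nonneg hc₀.le (hωI _).1

end AlloyModel
end

open AlloyModel in
theorem proposition6p10 (d : ℕ) (hd : 1 ≤ d)
    (μ : MeasureTheory.Measure ℝ) [MeasureTheory.IsProbabilityMeasure μ]
    (ε₀ : ℝ) (hε₀ : 0 < ε₀)
    (hμ : AlloyModel.couplingLaw d μ {ω | ω 0 < ε₀} ≤ 1 / 12)
    (C α uMean : ℝ) (hC : 0 < C) (hα : 0 < α) (huMean : 0 < uMean)
    (ξ κ β q ζ : ℝ) (hpar : AlloyModel.AdmissibleParameters d ξ κ β q)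
    (hζ : ζ ∈ Set.Ioo (2 - 2 * (1 - β) / κ) 2)
    (lstar : ℝ) :
    ∃ δ > 0, ∃ ε > 0, ∀ u : AlloyModel.Lattice d → ℝ,
      AlloyModel.ExponentialDecay u C α → ∑' k, u k = uMean →
      AlloyModel.SmallNegativePart u μ δ →
      AlloyModel.InitialScaleEstimate μ u (Set.Icc (-ε / 2) (ε / 2)) lstar ξ κ β q := by
  obtain ⟨T, c₀, hc₀, hT⟩ := exists_finset_forall_exists_le
    ((summable_exp_neg_mul_l1Norm d hα).mul_left C) huMean
  set c := min (c₀ * ε₀) 1 with hc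
  have hc0 : 0 < c := lt_min (mul_pos hc₀ hε₀) one_pos
  have hc1 : c ≤ 1 := min_le_right _ _
  have hd1 : (1 : ℝ) ≤ d := by exact_mod_cast hd
  -- Chosen so that `η = s / r` costs `2 * d * η ^ 2 = c / (8 * r ^ 2)`, a quarter of the gap `c /
  -- (2 * r ^ 2)`.
  set s := Real.sqrt (c / (16 * d)) with hs
  have hs0 : 0 < s := Real.sqrt_pos.2 (by positivity)
  have hssq : s ^ 2 = c / (16 * d) := Real.sq_sqrt (by positivity)
  have hs1 : s ≤ 1 := Real.sqrt_le_one.2 ((div_le_one (by positivity)).2 (by linarith))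
  obtain ⟨r, l, hr, hl, hlstar, hlT, hmass, hmass', hexp, hprob⟩ :=
    -- The sum of the norms over `T` dominates `k₀` whichever site of `T` it is, so `l` does not
    -- depend on `u`.
    exists_scales d hpar lstar ((∑ k ∈ T, l1Norm k : ℤ) : ℝ) (half_pos hs0)
      (by linarith) (show 0 < c / 8 by positivity)
  have hr0 : (0 : ℝ) < r := by exact_mod_cast hr
  have hr1 : (1 : ℝ) ≤ r := by exact_mod_cast hr
  set γ := c / 8 / (r : ℝ) ^ 2 with hγ
  have hγ0 : 0 < γ := by positivity
  -- The gap is `4 * γ`: one `γ` each goes to the negative part, the conjugation and the energy, and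
  -- one remains. The supremum stands for `ω₊`, which is only supplied together with `u`. The mass
  -- is `η / 2`; the other half of the decay absorbs the prefactor `1 / γ`.
  refine ⟨γ / (|sSup μ.support| + 1), by positivity, 2 * γ, by positivity,
    fun u hdec hsum hneg => ⟨hpar, s / 2 / r, l, by positivity, hl, hlstar, hmass, hmass', ?_⟩⟩
  obtain ⟨⟨uPos, uNeg, hp0, hn0, hps, hns, hn1, hu⟩, W, hW0, hW⟩ := hneg
  set δ := γ / (|sSup μ.support| + 1) with hδ
  have hδ0 : 0 ≤ δ := by positivity
  have hδW : δ * W ≤ γ := by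
    rw [hδ, hW, csSup_Icc hW0.le, abs_of_pos hW0, div_mul_eq_mul_div,
      div_le_iff₀ (by positivity)]
    nlinarith
  have hus : Summable u := (hps.sub (hns.mul_left δ)).congr fun k => (hu k).symm
  have huv : ∀ k, -(δ * uNeg k) ≤ u k := fun k => by
    rw [hu k]
    linarith [hp0 k]
  obtain ⟨k₀, hk₀T, hck⟩ := hT u hdec hsum
  have hk₀ : ∀ i, |k₀ i| ≤ l := by
    intro i
    have h1 : l1Norm k₀ ≤ ∑ k ∈ T, l1Norm k :=
      Finset.single_le_sum (f := l1Norm)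
        (fun k _ => Finset.sum_nonneg fun i _ => abs_nonneg _) hk₀T
    have h2 : ∑ k ∈ T, l1Norm k ≤ (l : ℤ) := by exact_mod_cast hlT
    exact (abs_apply_le_l1Norm k₀ i).trans (h1.trans h2)
  set i : Fin d := ⟨0, hd⟩
  intro z₁ z₂ _
  calc couplingLaw d μ (badEvent μ u l z₁ z₂ (s / 2 / r) (Set.Icc (-(2 * γ) / 2) (2 * γ / 2)))
      ≤ couplingLaw d μ {ω | ∃ x ∈ box z₁ l, ∀ j < r, ω (x + j • unitVec i - k₀) < ε₀} := by
        refine MeasureTheory.measure_mono ?_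
        -- The bad event requires both cubes to fail, so failure of the first one already bounds it.
        -- The segment event does not involve `E`, which covers all energies at once.
        rintro ω ⟨-, E, hE, hbad, -⟩
        by_contra hgood
        simp only [Set.mem_ofPred_eq, not_exists, not_and, not_forall, not_lt] at hgood
        refine hbad (isUniformlyRegular_of_segments μ hus hns hn0 hn1 hδ0 huv hW hk₀ hc₀ hck
          hc0 hc1 (min_le_left _ _) i hr z₁
          (fun x hx => by
            obtain ⟨j, hj, h⟩ := hgood x hx
            exact ⟨j, hj, h⟩)
          (η := s / r) (γ := γ) (by positivity) ((div_le_one hr0).2 (hs1.trans hr1)) hγ0 ?_ ?_)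
        · have hE2 : E ≤ γ := by linarith [hE.2]
          have hη : 2 * d * (s / r) ^ 2 = γ := by
            rw [div_pow, hssq, hγ]
            field_simp
            norm_num
          have hgap : c / (2 * (r : ℝ) ^ 2) = 4 * γ := by
            rw [hγ]
            field_simp
            norm_num
          rw [hη, hgap]
          linarith
        · have : s / 2 / r - s / r = -(s / 2 / r) := by ring
          rw [this]
          exact hexp
    _ ≤ ((2 * l + 1 : ℕ) : ENNReal) ^ d * (1 / 12) ^ r :=
        couplingLaw_exists_segment_le μ hμ z₁ k₀ i l r
    _ = ENNReal.ofReal ((2 * (l : ℝ) + 1) ^ d * (1 / 12) ^ r) := by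
        rw [ENNReal.ofReal_mul (by positivity), ENNReal.ofReal_pow (by positivity),
          ENNReal.ofReal_pow (by positivity), ENNReal.ofReal_div_of_pos (by norm_num)]
        congr 2
        · rw [← ENNReal.ofReal_natCast]
          push_cast
          rfl
        · simp
    _ ≤ _ := ENNReal.ofReal_le_ofReal hprob
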